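/- Fix a finite set $A$ of monadic predicate symbols and an infinite (countable) set of individual variables. A monadic model $\mathbb D=(D,V)$ is a possibly empty set $D$ with a map $V:A\to\wp(D)$. The formulas of $\mathtt{FOE}^\infty(A)$ are given by $$\varphi ::= \top\mid\bot\mid a(x)\mid\neg a(x)\mid x\approx y\mid x\not\approx y\mid\varphi\lor\varphi\mid\varphi\land\varphi\mid\exists x.\varphi\mid\forall x.\varphi\mid\exists^\infty x.\varphi\mid\forall^\infty x.\varphi,$$ where $\exists^\infty x$ and $\forall^\infty x$ mean "for infinitely many $x$" and "for all but at most finitely many $x$"; in the empty model, $\exists x.\varphi$ and $\exists^\infty x.\varphi$ are false and $\forall x.\varphi$ and $\forall^\infty x.\varphi$ are true. $\mathtt{FOE}(A)$ is the fragment without $\exists^\infty,\forall^\infty$, and $\mathtt{M}(A)$ is the fragment of $\mathtt{FOE}(A)$ without $\approx,\not\approx$. For each language $\mathcal L$ among these, $\mathcal L^+$ is its positive fragment, in which subformulas $\neg a(x)$ are not allowed. We write $\varphi\equiv\psi$ if the sentences $\varphi$ and $\psi$ are true in the same monadic models (the empty one included). A sentence $\varphi$ is invariant under quotients if $(D,V)\models\varphi$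 iff $(D',V')\models\varphi$ whenever there is a surjection $f:D\to D'$ with $d\in V(a)\Leftrightarrow f(d)\in V'(a)$ for all $a\in A$, $d\in D$. For $B\subseteq A$, the syntactically $B$-continuous formulas of $\mathtt{M}(A)$ are given by $\varphi::=\psi\mid b(x)\mid\varphi\land\varphi\mid\varphi\lor\varphi\mid\exists x.\varphi$ with $b\in B$ and $\psi\in\mathtt{M}(A\setminus B)$; those of $\mathtt{FOE}^\infty(A)$ are given by $\varphi::=\psi\mid b(x)\mid\varphi\land\varphi\mid\varphi\lor\varphi\mid\exists x.\varphi\mid \mathbf{W}x.(\varphi,\psi)$ with $b\in B$ and $\psi\in\mathtt{FOE}^\infty(A\setminus B)$, where $\mathbf{W}x.(\varphi,\psi):=\forall x.(\varphi\lor\psi)\land\forall^\infty x.\psi$. Theorem. There are effective (computable) translations $(\cdot)^\circ$, from sentences of $\mathtt{FOE}^+$ to sentences of $\mathtt{M}^+$, and $(\cdot)^\bullet$, from sentences of $(\mathtt{FOE}^\infty)^+$ to sentences of $\mathtt{M}^+$, such that for every sentence $\varphi$ of $\mathtt{FOE}^+$ (respectively, of $(\mathtt{FOE}^\infty)^+$),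 $\varphi\equiv\varphi^\circ$ (respectively, $\varphi\equiv\varphi^\bullet$) if and only if $\varphi$ is invariant under quotients. Moreover, $(\cdot)^\bullet$ can be chosen such that, for every $B\subseteq A$, it maps every syntactically $B$-continuous sentence of $(\mathtt{FOE}^\infty)^+$ to a syntactically $B$-continuous sentence of $\mathtt{M}^+$. -/

import Mathlib

universe u v

namespace MonadicLogic

/-- Monadic formulas (in negation normal form) over the predicate symbols `A`, with equality and
the generalised quantifiers "there are infinitely many" and "for all but finitely many".
The individual variables are the natural numbers. -/
inductive Formula (A : Type u) : Type u
  | top : Formula A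
  | bot : Formula A
  | pred (a : A) (x : ℕ) : Formula A
  | npred (a : A) (x : ℕ) : Formula A
  | eq (x y : ℕ) : Formula A
  | neq (x y : ℕ) : Formula A
  | or (φ ψ : Formula A) : Formula A
  | and (φ ψ : Formula A) : Formula A
  | ex (x : ℕ) (φ : Formula A) : Formula A
  | all (x : ℕ) (φ : Formula A) : Formula A
  | exInf (x : ℕ) (φ : Formula A) : Formula A
  | allInf (x : ℕ) (φ : Formula A) : Formula A

/-- A monadic model: a possibly empty domain, and a valuation of the predicate symbols. -/
structure Model (A : Type u) : Type (max u (v + 1)) where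
  domain : Type v
  val : A → Set domain

namespace Formula

variable {A : Type u}

/-- The free variables of a formula. -/
def freeVars : Formula A → Finset ℕ
  | top => ∅
  | bot => ∅
  | pred _ x => {x}
  | npred _ x => {x}
  | eq x y => {x, y}
  | neq x y => {x, y}
  | or φ ψ => freeVars φ ∪ freeVars ψ
  | and φ ψ => freeVars φ ∪ freeVars ψ
  | ex x φ => (freeVars φ).erase x
  | all x φ => (freeVars φ).erase x
  | exInf x φ => (freeVars φ).erase x
  | allInf x φ => (freeVars φ).erase x

/-- A sentence is a formula without free variables. -/
def IsSentence (φ : Formula A) : Prop := φ.freeVars = ∅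

/-- The set of predicate symbols occurring in a formula. -/
def preds : Formula A → Set A
  | top => ∅
  | bot => ∅
  | pred a _ => {a}
  | npred a _ => {a}
  | eq _ _ => ∅
  | neq _ _ => ∅
  | or φ ψ => preds φ ∪ preds ψ
  | and φ ψ => preds φ ∪ preds ψ
  | ex _ φ => preds φ
  | all _ φ => preds φ
  | exInf _ φ => preds φ
  | allInf _ φ => preds φ

/-- First-order logic with equality: no generalised quantifiers. -/
def IsFOE : Formula A → Prop
  | top => True
  | bot => True
  | pred _ _ => True
  | npred _ _ => True
  | eq _ _ => True
  | neq _ _ => True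
  | or φ ψ => IsFOE φ ∧ IsFOE ψ
  | and φ ψ => IsFOE φ ∧ IsFOE ψ
  | ex _ φ => IsFOE φ
  | all _ φ => IsFOE φ
  | exInf _ _ => False
  | allInf _ _ => False

/-- First-order logic without equality: neither (in)equalities nor generalised quantifiers. -/
def IsM : Formula A → Prop
  | top => True
  | bot => True
  | pred _ _ => True
  | npred _ _ => True
  | eq _ _ => False
  | neq _ _ => False
  | or φ ψ => IsM φ ∧ IsM ψ
  | and φ ψ => IsM φ ∧ IsM ψ
  | ex _ φ => IsM φ
  | all _ φ => IsM φ
  | exInf _ _ => False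
  | allInf _ _ => False

/-- Positive formulas: no negated predicate `¬ a(x)` (inequalities are allowed). -/
def IsPositive : Formula A → Prop
  | top => True
  | bot => True
  | pred _ _ => True
  | npred _ _ => False
  | eq _ _ => True
  | neq _ _ => True
  | or φ ψ => IsPositive φ ∧ IsPositive ψ
  | and φ ψ => IsPositive φ ∧ IsPositive ψ
  | ex _ φ => IsPositive φ
  | all _ φ => IsPositive φ
  | exInf _ φ => IsPositive φ
  | allInf _ φ => IsPositive φ

/-- The binary quantifier `W x.(φ, ψ) := ∀ x.(φ ∨ ψ) ∧ ∀^∞ x.ψ`. -/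
def W (x : ℕ) (φ ψ : Formula A) : Formula A := and (all x (or φ ψ)) (allInf x ψ)

/-- Formulas of first-order logic without equality that are syntactically continuous in `B`. -/
inductive IsContM (B : Set A) : Formula A → Prop
  | free (ψ : Formula A) (hM : IsM ψ) (hB : preds ψ ⊆ Bᶜ) : IsContM B ψ
  | pred (b : A) (hb : b ∈ B) (x : ℕ) : IsContM B (pred b x)
  | and (φ φ' : Formula A) (h : IsContM B φ) (h' : IsContM B φ') : IsContM B (and φ φ')
  | or (φ φ' : Formula A) (h : IsContM B φ) (h' : IsContM B φ') : IsContM B (or φ φ')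
  | ex (x : ℕ) (φ : Formula A) (h : IsContM B φ) : IsContM B (ex x φ)

/-- Formulas of the full language that are syntactically continuous in `B`. -/
inductive IsContFOEInf (B : Set A) : Formula A → Prop
  | free (ψ : Formula A) (hB : preds ψ ⊆ Bᶜ) : IsContFOEInf B ψ
  | pred (b : A) (hb : b ∈ B) (x : ℕ) : IsContFOEInf B (pred b x)
  | and (φ φ' : Formula A) (h : IsContFOEInf B φ) (h' : IsContFOEInf B φ') :
      IsContFOEInf B (and φ φ')
  | or (φ φ' : Formula A) (h : IsContFOEInf B φ) (h' : IsContFOEInf B φ') :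
      IsContFOEInf B (or φ φ')
  | ex (x : ℕ) (φ : Formula A) (h : IsContFOEInf B φ) : IsContFOEInf B (ex x φ)
  | w (x : ℕ) (φ ψ : Formula A) (h : IsContFOEInf B φ) (hB : preds ψ ⊆ Bᶜ) :
      IsContFOEInf B (W x φ ψ)

/-- Truth of a formula in a (nonempty) domain `D` with valuation `V` under the assignment `g`. -/
def Sat {D : Type v} (V : A → Set D) : Formula A → (ℕ → D) → Prop
  | top, _ => True
  | bot, _ => False
  | pred a x, g => g x ∈ V a
  | npred a x, g => g x ∉ V a
  | eq x y, g => g x = g y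
  | neq x y, g => g x ≠ g y
  | or φ ψ, g => Sat V φ g ∨ Sat V ψ g
  | and φ ψ, g => Sat V φ g ∧ Sat V ψ g
  | ex x φ, g => ∃ d, Sat V φ (Function.update g x d)
  | all x φ, g => ∀ d, Sat V φ (Function.update g x d)
  | exInf x φ, g => {d | Sat V φ (Function.update g x d)}.Infinite
  | allInf x φ, g => {d | ¬ Sat V φ (Function.update g x d)}.Finite

/-- Truth of a sentence in the empty model: existential quantifications fail and universal ones
hold. Atoms with variables are irrelevant here, as they are never reached from a sentence. -/
def TrueOnEmpty : Formula A → Prop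
  | top => True
  | bot => False
  | pred _ _ => False
  | npred _ _ => False
  | eq _ _ => False
  | neq _ _ => False
  | or φ ψ => TrueOnEmpty φ ∨ TrueOnEmpty ψ
  | and φ ψ => TrueOnEmpty φ ∧ TrueOnEmpty ψ
  | ex _ _ => False
  | all _ _ => True
  | exInf _ _ => False
  | allInf _ _ => True

/-- Truth depends only on the values of the free variables. -/
theorem sat_congr {D : Type v} (V : A → Set D) (φ : Formula A) :
    ∀ g g' : ℕ → D, (∀ x ∈ φ.freeVars, g x = g' x) → (Sat V φ g ↔ Sat V φ g') := by
  have key : ∀ (x : ℕ) (ψ : Formula A) (g g' : ℕ → D),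
      (∀ y ∈ (freeVars ψ).erase x, g y = g' y) →
      ∀ d, ∀ y ∈ freeVars ψ, Function.update g x d y = Function.update g' x d y := by
    intro x ψ g g' h d y hy
    by_cases hxy : y = x
    · subst hxy; simp
    · simp [hxy, h y (Finset.mem_erase.2 ⟨hxy, hy⟩)]
  induction φ with
  | top => intro g g' _; rfl
  | bot => intro g g' _; rfl
  | pred a x => intro g g' h; simp only [Sat, h x (by simp [freeVars])]
  | npred a x => intro g g' h; simp only [Sat, h x (by simp [freeVars])]
  | eq x y =>
    intro g g' h
    simp only [Sat, h x (by simp [freeVars]), h y (by simp [freeVars])]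
  | neq x y =>
    intro g g' h
    simp only [Sat, h x (by simp [freeVars]), h y (by simp [freeVars])]
  | or φ ψ ih ih' =>
    intro g g' h
    exact or_congr (ih g g' fun x hx => h x (Finset.mem_union_left _ hx))
      (ih' g g' fun x hx => h x (Finset.mem_union_right _ hx))
  | and φ ψ ih ih' =>
    intro g g' h
    exact and_congr (ih g g' fun x hx => h x (Finset.mem_union_left _ hx))
      (ih' g g' fun x hx => h x (Finset.mem_union_right _ hx))
  | ex x φ ih =>
    intro g g' h
    exact exists_congr fun d => ih _ _ (key x φ g g' h d)
  | all x φ ih =>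
    intro g g' h
    exact forall_congr' fun d => ih _ _ (key x φ g g' h d)
  | exInf x φ ih =>
    intro g g' h
    simp only [Sat, fun d => ih _ _ (key x φ g g' h d)]
  | allInf x φ ih =>
    intro g g' h
    simp only [Sat, fun d => ih _ _ (key x φ g g' h d)]

/-- A fixed Gödel numbering of the formulas. -/
def code [Encodable A] : Formula A → ℕ
  | top => Nat.pair 0 0
  | bot => Nat.pair 1 0
  | pred a x => Nat.pair 2 (Nat.pair (Encodable.encode a) x)
  | npred a x => Nat.pair 3 (Nat.pair (Encodable.encode a) x)
  | eq x y => Nat.pair 4 (Nat.pair x y)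
  | neq x y => Nat.pair 5 (Nat.pair x y)
  | or φ ψ => Nat.pair 6 (Nat.pair (code φ) (code ψ))
  | and φ ψ => Nat.pair 7 (Nat.pair (code φ) (code ψ))
  | ex x φ => Nat.pair 8 (Nat.pair x (code φ))
  | all x φ => Nat.pair 9 (Nat.pair x (code φ))
  | exInf x φ => Nat.pair 10 (Nat.pair x (code φ))
  | allInf x φ => Nat.pair 11 (Nat.pair x (code φ))

theorem code_injective [Encodable A] : Function.Injective (code : Formula A → ℕ) := by
  intro φ
  induction φ with
  | or φ ψ ih ih' =>
    intro χ h
    cases χ <;> simp [code, Nat.pair_eq_pair] at h ⊢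
    exact ⟨ih h.1, ih' h.2⟩
  | and φ ψ ih ih' =>
    intro χ h
    cases χ <;> simp [code, Nat.pair_eq_pair] at h ⊢
    exact ⟨ih h.1, ih' h.2⟩
  | ex x φ ih | all x φ ih | exInf x φ ih | allInf x φ ih =>
    intro χ h
    cases χ <;> simp [code, Nat.pair_eq_pair] at h ⊢
    exact ⟨h.1, ih h.2⟩
  | _ =>
    intro χ h
    cases χ <;> simp_all [code, Nat.pair_eq_pair]

end Formula

variable {A : Type u}

/-- Truth of a sentence in a model. If the domain is nonempty, the assignment `g` is arbitrary,
since a sentence has no free variables. -/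
def Models (M : Model.{u, v} A) (φ : Formula A) : Prop :=
  (IsEmpty M.domain ∧ φ.TrueOnEmpty) ∨ ∃ g : ℕ → M.domain, φ.Sat M.val g

/-- For a sentence, truth in a nonempty model is truth under any assignment. -/
theorem models_iff_sat (M : Model.{u, v} A) (φ : Formula A) (hφ : φ.IsSentence)
    (g : ℕ → M.domain) : Models M φ ↔ φ.Sat M.val g := by
  constructor
  · rintro (⟨h, -⟩ | ⟨g', h⟩)
    · exact (h.false (g 0)).elim
    · exact (φ.sat_congr M.val g' g (by rw [show φ.freeVars = ∅ from hφ]; simp)).1 h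
  · exact fun h => Or.inr ⟨g, h⟩

/-- Two sentences are equivalent if they are true in the same models. -/
def Equivalent (φ ψ : Formula A) : Prop :=
  ∀ M : Model.{u, v} A, Models M φ ↔ Models M ψ

/-- A (strong) homomorphism of monadic models. -/
def IsHom (M N : Model.{u, v} A) (f : M.domain → N.domain) : Prop :=
  ∀ (a : A) (d : M.domain), d ∈ M.val a ↔ f d ∈ N.val a

/-- `N` is a quotient of `M`. -/
def IsQuotient (N M : Model.{u, v} A) : Prop :=
  ∃ f : M.domain → N.domain, IsHom M N f ∧ Function.Surjective f

/-- Invariance of a sentence under taking quotients. -/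
def InvariantUnderQuotients (φ : Formula A) : Prop :=
  ∀ M N : Model.{u, v} A, IsQuotient N M → (Models M φ ↔ Models N φ)

variable (A) in
/-- The positive sentences of first-order logic with equality. -/
def PosFOE : Set (Formula A) := {φ | φ.IsSentence ∧ φ.IsFOE ∧ φ.IsPositive}

variable (A) in
/-- The positive sentences of first-order logic with equality and generalised quantifiers. -/
def PosFOEInf : Set (Formula A) := {φ | φ.IsSentence ∧ φ.IsPositive}

variable (A) in
/-- The positive sentences of first-order logic without equality. -/
def PosM : Set (Formula A) := {φ | φ.IsSentence ∧ φ.IsM ∧ φ.IsPositive}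

/-- A translation between sets of formulas is effective if it is induced by a computable function
on Gödel numbers. -/
def IsEffective [Encodable A] {S T : Set (Formula A)} (t : S → T) : Prop :=
  ∃ F : ℕ → ℕ, Computable F ∧ ∀ φ : S, F (φ : Formula A).code = (t φ : Formula A).code

end MonadicLogic

open MonadicLogic

/-!
One translation serves both languages. For a model `M`, let `M.blowUp` be the model in which every
element of `M` is copied infinitely often. The translation `φ ↦ φ.translate []` produces sentences
without equality such that `M` satisfies `φ.translate []` iff `M.blowUp` satisfies `φ`
(`models_translate_iff`). As `M` is a quotient of `M.blowUp`, a sentence that is invariant under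
quotients is equivalent to its translation; conversely, sentences without equality and generalised
quantifiers are invariant under quotients, hence so is every sentence that is equivalent to its
translation (`equivalent_translate_iff`).

In `M.blowUp` equality and the generalised quantifiers can be eliminated. An element that differs
from the finitely many elements named so far can be replaced by infinitely many others with the same
projection to `M`. So `∃ x.φ` splits into finitely many cases in which `x` is a named element, and
the case in which `x` is a fresh one, while `∃^∞ x.φ` is the fresh case alone; dually for `∀ x.φ`
and `∀^∞ x.φ`. The translation therefore carries an environment that identifies each variable with a
named element: it decides the equalities, and the values of the named elements only matter through
their projections (`correct_translate`).

This keeps formulas positive, and also keeps them continuous in `B`, except at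
`W x.(φ, ψ) = ∀ x.(φ ∨ ψ) ∧ ∀^∞ x.ψ`, where the fresh case of the first conjunct would put `φ` under a
universal quantifier. That case follows from the translation of `∀^∞ x.ψ` and is left out
(`isContM_translate`).

On Gödel numbers the translation is a recursion along a decreasing measure, with changing
environments; Mathlib's `Primrec.nat_omega_rec'` makes it primitive recursive
(`primrec_translateCode`).
-/

namespace MonadicLogic

/-! ### The translation -/

namespace Formula

variable {A : Type u}

/-- The disjunction of a list of formulas. -/
def bigOr (l : List (Formula A)) : Formula A := l.foldr or bot

/-- The conjunction of a list of formulas. -/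
def bigAnd (l : List (Formula A)) : Formula A := l.foldr and top

/-- The first conjunct of a conjunction; other formulas are left alone. -/
def leftConjunct : Formula A → Formula A
  | and φ _ => φ
  | φ => φ

/-- The pairs of formulas whose conjunction is of the form `W x.(α, β)`. -/
def IsWPair (φ ψ : Formula A) : Prop := ∃ x α β, φ = all x (or α β) ∧ ψ = allInf x β

/-- The output variable that the environment `e` assigns to the source variable `x`; the value `0`
at unassigned variables is junk. -/
def value (e : List (ℕ × ℕ)) (x : ℕ) : ℕ := (e.lookup x).getD 0

/-- The translation, relative to an environment `e` that assigns output variables to the source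
variables in scope. Distinct output variables stand for distinct elements, so that equality is
decided by the environment. The output variables in use are the second components of `e`; they are
below `e.length`, which is therefore fresh. -/
noncomputable def translate : Formula A → List (ℕ × ℕ) → Formula A
  | top, _ => top
  | bot, _ => bot
  | pred a x, e => pred a (value e x)
  | npred a x, e => npred a (value e x)
  | eq x y, e => if value e x = value e y then top else bot
  | neq x y, e => if value e x = value e y then bot else top
  | or φ ψ, e => or (translate φ e) (translate ψ e)
  | and φ ψ, e =>
    -- In `W x.(α, β)` the conjunct for fresh elements of `∀ x.(α ∨ β)` is implied by `∀^∞ x.β`.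
    open Classical in
    if IsWPair φ ψ then and (leftConjunct (translate φ e)) (translate ψ e)
    else and (translate φ e) (translate ψ e)
  | ex x φ, e =>
    or (bigOr (e.map fun p => translate φ ((x, p.2) :: e)))
      (ex e.length (translate φ ((x, e.length) :: e)))
  | all x φ, e =>
    and (bigAnd (e.map fun p => translate φ ((x, p.2) :: e)))
      (all e.length (translate φ ((x, e.length) :: e)))
  | exInf x φ, e => ex e.length (translate φ ((x, e.length) :: e))
  | allInf x φ, e => all e.length (translate φ ((x, e.length) :: e))

/-! ### Syntactic properties of the translation -/

theorem bigOr_map_induction {ι : Type*} {P : Formula A → Prop} (hbot : P bot)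
    (hor : ∀ φ ψ, P φ → P ψ → P (or φ ψ)) {f : ι → Formula A} {l : List ι}
    (h : ∀ p ∈ l, P (f p)) : P (bigOr (l.map f)) := by
  induction l with
  | nil => exact hbot
  | cons p l ih => exact hor _ _ (h p (by simp)) (ih fun q hq => h q (by simp [hq]))

theorem bigAnd_map_induction {ι : Type*} {P : Formula A → Prop} (htop : P top)
    (hand : ∀ φ ψ, P φ → P ψ → P (and φ ψ)) {f : ι → Formula A} {l : List ι}
    (h : ∀ p ∈ l, P (f p)) : P (bigAnd (l.map f)) := by
  induction l with
  | nil => exact htop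
  | cons p l ih => exact hand _ _ (h p (by simp)) (ih fun q hq => h q (by simp [hq]))

theorem isM_leftConjunct {φ : Formula A} (h : IsM φ) : IsM (leftConjunct φ) := by
  cases φ with
  | and φ ψ => exact h.1
  | _ => exact h

theorem isPositive_leftConjunct {φ : Formula A} (h : IsPositive φ) :
    IsPositive (leftConjunct φ) := by
  cases φ with
  | and φ ψ => exact h.1
  | _ => exact h

theorem preds_leftConjunct (φ : Formula A) : preds (leftConjunct φ) ⊆ preds φ := by
  cases φ with
  | and φ ψ => exact Set.subset_union_left
  | _ => exact subset_rfl

theorem freeVars_leftConjunct (φ : Formula A) : freeVars (leftConjunct φ) ⊆ freeVars φ := by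
  cases φ with
  | and φ ψ => exact Finset.subset_union_left
  | _ => exact subset_rfl

theorem isM_translate (φ : Formula A) : ∀ e, IsM (translate φ e) := by
  induction φ with
  | top | bot | pred | npred => intro e; trivial
  | eq | neq => intro e; simp only [translate]; split_ifs <;> trivial
  | or φ ψ ih ih' => intro e; exact ⟨ih e, ih' e⟩
  | and φ ψ ih ih' =>
    intro e
    simp only [translate]
    split_ifs
    · exact ⟨isM_leftConjunct (ih e), ih' e⟩
    · exact ⟨ih e, ih' e⟩
  | ex x φ ih =>
    intro e
    exact ⟨bigOr_map_induction (P := IsM) trivial (fun _ _ => .intro)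
      fun _ _ => ih _, ih _⟩
  | all x φ ih =>
    intro e
    exact ⟨bigAnd_map_induction (P := IsM) trivial (fun _ _ => .intro)
      fun _ _ => ih _, ih _⟩
  | exInf x φ ih | allInf x φ ih => intro e; exact ih _

theorem isPositive_translate (φ : Formula A) (h : IsPositive φ) :
    ∀ e, IsPositive (translate φ e) := by
  induction φ with
  | top | bot | pred => intro e; trivial
  | npred => exact h.elim
  | eq | neq => intro e; simp only [translate]; split_ifs <;> trivial
  | or φ ψ ih ih' => intro e; exact ⟨ih h.1 e, ih' h.2 e⟩
  | and φ ψ ih ih' =>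
    intro e
    simp only [translate]
    split_ifs
    · exact ⟨isPositive_leftConjunct (ih h.1 e), ih' h.2 e⟩
    · exact ⟨ih h.1 e, ih' h.2 e⟩
  | ex x φ ih =>
    intro e
    exact ⟨bigOr_map_induction (P := IsPositive) trivial (fun _ _ => .intro)
      fun _ _ => ih h _, ih h _⟩
  | all x φ ih =>
    intro e
    exact ⟨bigAnd_map_induction (P := IsPositive) trivial (fun _ _ => .intro)
      fun _ _ => ih h _, ih h _⟩
  | exInf x φ ih | allInf x φ ih => intro e; exact ih h _

theorem preds_translate (φ : Formula A) : ∀ e, preds (translate φ e) ⊆ preds φ := by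
  induction φ with
  | top | bot | pred | npred => intro e; exact subset_rfl
  | eq | neq => intro e; simp only [translate]; split_ifs <;> exact subset_rfl
  | or φ ψ ih ih' => intro e; exact Set.union_subset_union (ih e) (ih' e)
  | and φ ψ ih ih' =>
    intro e
    simp only [translate]
    split_ifs
    · exact Set.union_subset_union ((preds_leftConjunct _).trans (ih e)) (ih' e)
    · exact Set.union_subset_union (ih e) (ih' e)
  | ex x φ ih =>
    intro e
    exact Set.union_subset (bigOr_map_induction (P := fun ψ => preds ψ ⊆ preds φ)
      (Set.empty_subset _) (fun _ _ => Set.union_subset) fun _ _ => ih _) (ih _)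
  | all x φ ih =>
    intro e
    exact Set.union_subset (bigAnd_map_induction (P := fun ψ => preds ψ ⊆ preds φ)
      (Set.empty_subset _) (fun _ _ => Set.union_subset) fun _ _ => ih _) (ih _)
  | exInf x φ ih | allInf x φ ih => intro e; exact ih _

@[simp] theorem value_cons (e : List (ℕ × ℕ)) (x i y : ℕ) :
    value ((x, i) :: e) y = Function.update (value e) x i y := by
  by_cases h : y = x
  · subst h; simp [value, List.lookup]
  · have : (y == x) = false := by simpa using h
    simp [value, List.lookup, h, this]

theorem value_mem {e : List (ℕ × ℕ)} {x : ℕ} (hx : x ∈ (e.map Prod.fst).toFinset) :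
    value e x ∈ (e.map Prod.snd).toFinset := by
  induction e with
  | nil => simp at hx
  | cons p e ih =>
    obtain ⟨y, i⟩ := p
    rw [value_cons]
    by_cases h : x = y
    · subst h; simp
    · have := ih (by simpa [h] using hx)
      rw [Function.update_of_ne h, List.map_cons, List.toFinset_cons]
      exact Finset.mem_insert_of_mem this

/-- The scoping condition passes to the body of a quantifier. -/
theorem freeVars_subset_cons {φ : Formula A} {x i : ℕ} {e : List (ℕ × ℕ)}
    (h : (freeVars φ).erase x ⊆ (e.map Prod.fst).toFinset) :
    freeVars φ ⊆ (((x, i) :: e).map Prod.fst).toFinset := by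
  rw [List.map_cons, List.toFinset_cons]
  exact Finset.subset_insert_iff.2 h

theorem freeVars_translate (φ : Formula A) :
    ∀ e : List (ℕ × ℕ), freeVars φ ⊆ (e.map Prod.fst).toFinset →
      freeVars (translate φ e) ⊆ (e.map Prod.snd).toFinset := by
  have fresh : ∀ (φ : Formula A) (x : ℕ) (e : List (ℕ × ℕ)),
      freeVars (translate φ ((x, e.length) :: e)) ⊆
        (((x, e.length) :: e).map Prod.snd).toFinset →
      (freeVars (translate φ ((x, e.length) :: e))).erase e.length ⊆
        (e.map Prod.snd).toFinset := by
    intro φ x e h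
    rw [List.map_cons, List.toFinset_cons] at h
    exact Finset.subset_insert_iff.1 h
  have old : ∀ (φ : Formula A) (x : ℕ) (e : List (ℕ × ℕ)) (p : ℕ × ℕ), p ∈ e →
      freeVars (translate φ ((x, p.2) :: e)) ⊆ (((x, p.2) :: e).map Prod.snd).toFinset →
      freeVars (translate φ ((x, p.2) :: e)) ⊆ (e.map Prod.snd).toFinset := by
    intro φ x e p hp h
    rwa [List.map_cons, List.toFinset_cons, Finset.insert_eq_of_mem] at h
    exact List.mem_toFinset.2 (List.mem_map.2 ⟨p, hp, rfl⟩)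
  induction φ with
  | top | bot => intro e _; exact Finset.empty_subset _
  | pred a x | npred a x =>
    intro e h
    exact Finset.singleton_subset_iff.2 (value_mem (Finset.singleton_subset_iff.1 h))
  | eq | neq =>
    intro e _
    simp only [translate]
    split_ifs <;> exact Finset.empty_subset _
  | or φ ψ ih ih' =>
    intro e h
    have h := Finset.union_subset_iff.1 h
    exact Finset.union_subset (ih e h.1) (ih' e h.2)
  | and φ ψ ih ih' =>
    intro e h
    have h := Finset.union_subset_iff.1 h
    simp only [translate]
    split_ifs
    · exact Finset.union_subset ((freeVars_leftConjunct _).trans (ih e h.1)) (ih' e h.2)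
    · exact Finset.union_subset (ih e h.1) (ih' e h.2)
  | ex x φ ih =>
    intro e h
    exact Finset.union_subset
      (bigOr_map_induction (P := fun ψ => freeVars ψ ⊆ (e.map Prod.snd).toFinset)
        (Finset.empty_subset _) (fun _ _ => Finset.union_subset)
        fun p hp => old φ x e p hp (ih _ (freeVars_subset_cons h)))
      (fresh φ x e (ih _ (freeVars_subset_cons h)))
  | all x φ ih =>
    intro e h
    exact Finset.union_subset
      (bigAnd_map_induction (P := fun ψ => freeVars ψ ⊆ (e.map Prod.snd).toFinset)
        (Finset.empty_subset _) (fun _ _ => Finset.union_subset)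
        fun p hp => old φ x e p hp (ih _ (freeVars_subset_cons h)))
      (fresh φ x e (ih _ (freeVars_subset_cons h)))
  | exInf x φ ih | allInf x φ ih =>
    intro e h
    exact fresh φ x e (ih _ (freeVars_subset_cons h))

/-- A universally quantified formula is continuous only if it avoids `B` altogether. -/
theorem IsContFOEInf.preds_all {B : Set A} {x : ℕ} {φ : Formula A}
    (h : IsContFOEInf B (all x φ)) : preds φ ⊆ Bᶜ := by
  cases h with
  | free _ h => exact h

theorem IsContFOEInf.preds_allInf {B : Set A} {x : ℕ} {φ : Formula A}
    (h : IsContFOEInf B (allInf x φ)) : preds φ ⊆ Bᶜ := by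
  cases h with
  | free _ h => exact h

theorem isContM_translate_of_preds {B : Set A} {φ : Formula A} (h : preds φ ⊆ Bᶜ)
    (e : List (ℕ × ℕ)) : IsContM B (translate φ e) :=
  .free _ (isM_translate φ e) ((preds_translate φ e).trans h)

theorem isContM_translate {B : Set A} {φ : Formula A} (h : IsContFOEInf B φ) :
    ∀ e, IsContM B (translate φ e) := by
  induction h with
  | free ψ h => exact isContM_translate_of_preds h
  | pred b hb x => intro e; exact .pred b hb _
  | or φ ψ _ _ ih ih' => intro e; exact .or _ _ (ih e) (ih' e)
  | and φ ψ h h' ih ih' =>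
    intro e
    by_cases hW : IsWPair φ ψ
    · obtain ⟨x, α, β, rfl, rfl⟩ := hW
      exact isContM_translate_of_preds (Set.union_subset h.preds_all h'.preds_allInf) e
    · simp only [translate, if_neg hW]
      exact .and _ _ (ih e) (ih' e)
  | ex x φ _ ih =>
    intro e
    exact .or _ _ (bigOr_map_induction (.free _ trivial (Set.empty_subset _)) .or fun _ _ => ih _)
      (.ex _ _ (ih _))
  | w x φ ψ _ hB ih =>
    intro e
    have hW : IsWPair (all x (or φ ψ)) (allInf x ψ) := ⟨x, φ, ψ, rfl, rfl⟩
    simp only [W, translate, if_pos hW]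
    exact .and _ _
      (bigAnd_map_induction (.free _ trivial (Set.empty_subset _)) .and
        fun _ _ => .or _ _ (ih _) (isContM_translate_of_preds hB _))
      (isContM_translate_of_preds (φ := allInf x ψ) hB e)

/-! ### Semantics of the translation -/

theorem sat_bigOr {D : Type v} (V : A → Set D) (l : List (Formula A)) (g : ℕ → D) :
    Sat V (bigOr l) g ↔ ∃ φ ∈ l, Sat V φ g := by
  induction l with
  | nil => simp [bigOr, Sat]
  | cons φ l ih =>
    change Sat V φ g ∨ Sat V (bigOr l) g ↔ _
    rw [ih, List.exists_mem_cons_iff]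

theorem sat_bigAnd {D : Type v} (V : A → Set D) (l : List (Formula A)) (g : ℕ → D) :
    Sat V (bigAnd l) g ↔ ∀ φ ∈ l, Sat V φ g := by
  induction l with
  | nil => simp [bigAnd, Sat]
  | cons φ l ih =>
    change Sat V φ g ∧ Sat V (bigAnd l) g ↔ _
    rw [ih, List.forall_mem_cons]

/-- The valuation on `D × ℕ` in which every element of `D` is copied infinitely often. -/
def blowUp {D : Type v} (V : A → Set D) (a : A) : Set (D × ℕ) := {p | p.1 ∈ V a}

/-- The shape of the semantic correctness of the translation, as an induction hypothesis. -/
def Correct {D : Type v} (V : A → Set D) (φ : Formula A) : Prop :=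
  ∀ (e : List (ℕ × ℕ)) (h : ℕ → D × ℕ), Set.InjOn h {i | i ∈ e.map Prod.snd} →
    (∀ p ∈ e, p.2 < e.length) → freeVars φ ⊆ (e.map Prod.fst).toFinset →
    (Sat (blowUp V) φ (fun x => h (value e x)) ↔ Sat V (translate φ e) (fun i => (h i).1))

section Quantifiers

variable {D : Type v} {V : A → Set D} {φ : Formula A} {x : ℕ} {e : List (ℕ × ℕ)} {h : ℕ → D × ℕ}

/-- The body of a quantifier at an element that is the value of an output variable in use. -/
theorem Correct.old (hc : Correct V φ) (hinj : Set.InjOn h {i | i ∈ e.map Prod.snd})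
    (hlt : ∀ p ∈ e, p.2 < e.length) (hfv : (freeVars φ).erase x ⊆ (e.map Prod.fst).toFinset)
    {p : ℕ × ℕ} (hp : p ∈ e) :
    Sat (blowUp V) φ (Function.update (fun y => h (value e y)) x (h p.2)) ↔
      Sat V (translate φ ((x, p.2) :: e)) (fun i => (h i).1) := by
  rw [← hc ((x, p.2) :: e) h ?_ ?_ (freeVars_subset_cons hfv)]
  · refine iff_of_eq (congrArg _ (funext fun y => ?_))
    rw [value_cons]
    by_cases hy : y = x
    · subst hy; simp
    · simp [hy]
  · refine hinj.mono fun i hi => ?_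
    rcases List.mem_cons.1 hi with rfl | hi
    · exact List.mem_map.2 ⟨p, hp, rfl⟩
    · exact hi
  · intro q hq
    rw [List.length_cons]
    rcases List.mem_cons.1 hq with rfl | hq
    · exact (hlt p hp).trans (Nat.lt_succ_self _)
    · exact (hlt q hq).trans (Nat.lt_succ_self _)

/-- The body of a quantifier at an element that differs from the values of all output variables
in use. -/
theorem Correct.fresh (hc : Correct V φ) (hinj : Set.InjOn h {i | i ∈ e.map Prod.snd})
    (hlt : ∀ p ∈ e, p.2 < e.length) (hfv : (freeVars φ).erase x ⊆ (e.map Prod.fst).toFinset)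
    {d : D × ℕ} (hd : d ∉ h '' {i | i ∈ e.map Prod.snd}) :
    Sat (blowUp V) φ (Function.update (fun y => h (value e y)) x d) ↔
      Sat V (translate φ ((x, e.length) :: e))
        (Function.update (fun i => (h i).1) e.length d.1) := by
  have hlt' : ∀ i ∈ e.map Prod.snd, i ≠ e.length := by
    intro i hi
    obtain ⟨p, hp, rfl⟩ := List.mem_map.1 hi
    exact (hlt p hp).ne
  have hupd : (Function.update (fun i => (h i).1) e.length d.1) =
      fun i => (Function.update h e.length d i).1 := by
    funext i
    by_cases hi : i = e.length
    · subst hi; simp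
    · simp [hi]
  rw [hupd, ← hc ((x, e.length) :: e) (Function.update h e.length d) ?_ ?_
    (freeVars_subset_cons hfv)]
  · refine sat_congr _ _ _ _ fun y hy => ?_
    rw [value_cons]
    by_cases hyx : y = x
    · subst hyx; simp
    · have := hlt' _ (List.mem_toFinset.1
        (value_mem (hfv (Finset.mem_erase.2 ⟨hyx, hy⟩))))
      simp [hyx, this]
  · intro i hi j hj hij
    have key : ∀ i ∈ e.map Prod.snd, h i ≠ d := fun i hi hid => hd ⟨i, hi, hid⟩
    rcases List.mem_cons.1 hi with rfl | hi <;> rcases List.mem_cons.1 hj with rfl | hj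
    · rfl
    · simp [hlt' j hj] at hij
      exact absurd hij.symm (key j hj)
    · simp [hlt' i hi] at hij
      exact absurd hij (key i hi)
    · simp only [Function.update_of_ne (hlt' i hi), Function.update_of_ne (hlt' j hj)] at hij
      exact hinj hi hj hij
  · intro q hq
    rw [List.length_cons]
    rcases List.mem_cons.1 hq with rfl | hq
    · exact Nat.lt_succ_self _
    · exact (hlt q hq).trans (Nat.lt_succ_self _)

theorem finite_used (h : ℕ → D × ℕ) (e : List (ℕ × ℕ)) :
    (h '' {i | i ∈ e.map Prod.snd}).Finite := (List.finite_toSet _).image _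

/-- All but finitely many copies of an element of `D` are fresh. -/
theorem infinite_fresh (h : ℕ → D × ℕ) (e : List (ℕ × ℕ)) (c : D) :
    {d : D × ℕ | d.1 = c ∧ d ∉ h '' {i | i ∈ e.map Prod.snd}}.Infinite := by
  have : (Set.range fun n : ℕ => (c, n)).Infinite :=
    Set.infinite_range_of_injective fun m n hmn => (Prod.mk.inj hmn).2
  refine (this.sdiff (finite_used h e)).mono ?_
  rintro _ ⟨⟨n, rfl⟩, hn⟩
  exact ⟨rfl, hn⟩

end Quantifiers

theorem correct_translate {D : Type v} (V : A → Set D) (φ : Formula A) : Correct V φ := by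
  induction φ with
  | top | bot => intro e h _ _ _; exact Iff.rfl
  | pred a x | npred a x => intro e h _ _ _; exact Iff.rfl
  | eq x y =>
    intro e h hinj _ hfv
    have hx := List.mem_toFinset.1 (value_mem (hfv (show x ∈ ({x, y} : Finset ℕ) by simp)))
    have hy := List.mem_toFinset.1 (value_mem (hfv (show y ∈ ({x, y} : Finset ℕ) by simp)))
    simp only [Sat, translate, hinj.eq_iff hx hy]
    split_ifs with hxy <;> simp [Sat, hxy]
  | neq x y =>
    intro e h hinj _ hfv
    have hx := List.mem_toFinset.1 (value_mem (hfv (show x ∈ ({x, y} : Finset ℕ) by simp)))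
    have hy := List.mem_toFinset.1 (value_mem (hfv (show y ∈ ({x, y} : Finset ℕ) by simp)))
    simp only [Sat, translate, ne_eq, hinj.eq_iff hx hy]
    split_ifs with hxy <;> simp [Sat, hxy]
  | or φ ψ ih ih' =>
    intro e h hinj hlt hfv
    have hfv := Finset.union_subset_iff.1 hfv
    exact or_congr (ih e h hinj hlt hfv.1) (ih' e h hinj hlt hfv.2)
  | and φ ψ ih ih' =>
    intro e h hinj hlt hfv
    have hfv := Finset.union_subset_iff.1 hfv
    have key := and_congr (ih e h hinj hlt hfv.1) (ih' e h hinj hlt hfv.2)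
    by_cases hW : IsWPair φ ψ
    · simp only [translate, if_pos hW]
      obtain ⟨x, α, β, rfl, rfl⟩ := hW
      refine key.trans ⟨fun ⟨h₁, h₂⟩ => ⟨h₁.1, h₂⟩, fun ⟨h₁, h₂⟩ => ⟨⟨h₁, ?_⟩, h₂⟩⟩
      exact fun d => Or.inr (h₂ d)
    · simp only [translate, if_neg hW]
      exact key
  | ex x φ ih =>
    intro e h hinj hlt hfv
    simp only [translate, Sat, sat_bigOr, List.mem_map]
    constructor
    · rintro ⟨d, hd⟩
      by_cases hdu : d ∈ h '' {i | i ∈ e.map Prod.snd}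
      · obtain ⟨i, hi, rfl⟩ := hdu
        obtain ⟨p, hp, rfl⟩ := List.mem_map.1 hi
        exact Or.inl ⟨_, ⟨p, hp, rfl⟩, (ih.old hinj hlt hfv hp).1 hd⟩
      · exact Or.inr ⟨d.1, (ih.fresh hinj hlt hfv hdu).1 hd⟩
    · rintro (⟨_, ⟨p, hp, rfl⟩, hs⟩ | ⟨c, hs⟩)
      · exact ⟨_, (ih.old hinj hlt hfv hp).2 hs⟩
      · obtain ⟨d, rfl, hd⟩ := (infinite_fresh h e c).nonempty
        exact ⟨d, (ih.fresh hinj hlt hfv hd).2 hs⟩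
  | all x φ ih =>
    intro e h hinj hlt hfv
    simp only [translate, Sat, sat_bigAnd, List.mem_map]
    constructor
    · intro hs
      refine ⟨?_, fun c => ?_⟩
      · rintro _ ⟨p, hp, rfl⟩
        exact (ih.old hinj hlt hfv hp).1 (hs _)
      · obtain ⟨d, rfl, hd⟩ := (infinite_fresh h e c).nonempty
        exact (ih.fresh hinj hlt hfv hd).1 (hs d)
    · rintro ⟨h₁, h₂⟩ d
      by_cases hdu : d ∈ h '' {i | i ∈ e.map Prod.snd}
      · obtain ⟨i, hi, rfl⟩ := hdu
        obtain ⟨p, hp, rfl⟩ := List.mem_map.1 hi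
        exact (ih.old hinj hlt hfv hp).2 (h₁ _ ⟨p, hp, rfl⟩)
      · exact (ih.fresh hinj hlt hfv hdu).2 (h₂ d.1)
  | exInf x φ ih =>
    intro e h hinj hlt hfv
    simp only [translate, Sat]
    constructor
    · intro hs
      obtain ⟨d, hd, hdu⟩ := (hs.sdiff (finite_used h e)).nonempty
      exact ⟨d.1, (ih.fresh hinj hlt hfv hdu).1 hd⟩
    · rintro ⟨c, hs⟩
      refine (infinite_fresh h e c).mono ?_
      rintro d ⟨rfl, hd⟩
      exact (ih.fresh hinj hlt hfv hd).2 hs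
  | allInf x φ ih =>
    intro e h hinj hlt hfv
    simp only [translate, Sat]
    constructor
    · intro hs c
      -- Infinitely many fresh copies of `c` cannot all be among the finitely many exceptions.
      obtain ⟨d, ⟨rfl, hd⟩, hds⟩ := ((infinite_fresh h e c).sdiff hs).nonempty
      exact (ih.fresh hinj hlt hfv hd).1 (not_not.1 hds)
    · intro hs
      refine (finite_used h e).subset fun d hd => ?_
      by_contra hdu
      exact hd ((ih.fresh hinj hlt hfv hdu).2 (hs d.1))

/-- In the empty model a sentence and its translation agree. -/
theorem trueOnEmpty_translate (φ : Formula A) (hφ : φ.IsSentence) :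
    TrueOnEmpty (translate φ []) ↔ TrueOnEmpty φ := by
  induction φ with
  | top | bot => exact Iff.rfl
  | pred | npred | eq | neq => simp [IsSentence, freeVars] at hφ
  | or φ ψ ih ih' =>
    have hφ := Finset.union_eq_empty.1 hφ
    exact or_congr (ih hφ.1) (ih' hφ.2)
  | and φ ψ ih ih' =>
    have hφ := Finset.union_eq_empty.1 hφ
    by_cases hW : IsWPair φ ψ
    · simp only [translate, if_pos hW]
      obtain ⟨x, α, β, rfl, rfl⟩ := hW
      simp [translate, leftConjunct, TrueOnEmpty, bigAnd]
    · simp only [translate, if_neg hW]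
      exact and_congr (ih hφ.1) (ih' hφ.2)
  | ex | all | exInf | allInf => simp [translate, TrueOnEmpty, bigOr, bigAnd]

theorem isSentence_translate {φ : Formula A} (hφ : φ.IsSentence) :
    (translate φ []).IsSentence := by
  have := freeVars_translate φ [] (by rw [show φ.freeVars = ∅ from hφ]; exact subset_rfl)
  exact Finset.subset_empty.1 this

/-- Formulas without equality and generalised quantifiers are preserved and reflected by
surjective homomorphisms. -/
theorem sat_of_isM {D E : Type v} {V : A → Set D} {U : A → Set E} {f : D → E}
    (hf : ∀ a d, d ∈ V a ↔ f d ∈ U a) (hs : Function.Surjective f) (φ : Formula A) (hφ : IsM φ) :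
    ∀ g : ℕ → D, Sat V φ g ↔ Sat U φ (f ∘ g) := by
  induction φ with
  | top | bot => intro g; exact Iff.rfl
  | pred a x => intro g; exact hf a _
  | npred a x => intro g; exact not_congr (hf a _)
  | eq | neq | exInf | allInf => exact hφ.elim
  | or φ ψ ih ih' => intro g; exact or_congr (ih hφ.1 g) (ih' hφ.2 g)
  | and φ ψ ih ih' => intro g; exact and_congr (ih hφ.1 g) (ih' hφ.2 g)
  | ex x φ ih =>
    intro g
    simp only [Sat, hs.exists, ih hφ, Function.comp_update]
  | all x φ ih =>
    intro g
    simp only [Sat, hs.forall, ih hφ, Function.comp_update]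

end Formula

/-! ### Invariance under quotients -/

open Formula

variable {A : Type u}

theorem models_of_isEmpty (M : Model.{u, v} A) [IsEmpty M.domain] (φ : Formula A) :
    Models M φ ↔ φ.TrueOnEmpty := by
  constructor
  · rintro (⟨-, h⟩ | ⟨g, -⟩)
    · exact h
    · exact isEmptyElim (g 0)
  · exact fun h => Or.inl ⟨inferInstance, h⟩

theorem invariantUnderQuotients_of_isM {φ : Formula A} (hs : φ.IsSentence) (hφ : φ.IsM) :
    InvariantUnderQuotients.{u, v} φ := by
  rintro M N ⟨f, hf, hsurj⟩
  rcases isEmpty_or_nonempty M.domain with hM | ⟨⟨d⟩⟩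
  · have hN : IsEmpty N.domain := ⟨fun n => hM.false (hsurj n).choose⟩
    rw [models_of_isEmpty, models_of_isEmpty]
  · rw [models_iff_sat M φ hs fun _ => d, models_iff_sat N φ hs (f ∘ fun _ => d)]
    exact sat_of_isM hf hsurj φ hφ _

/-- The model in which every element of `M` is copied infinitely often. -/
def Model.blowUp (M : Model.{u, v} A) : Model.{u, v} A := ⟨M.domain × ℕ, Formula.blowUp M.val⟩

theorem isQuotient_blowUp (M : Model.{u, v} A) : IsQuotient M M.blowUp :=
  ⟨Prod.fst, fun _ _ => Iff.rfl, fun d => ⟨(d, 0), rfl⟩⟩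

theorem models_translate_iff (M : Model.{u, v} A) {φ : Formula A} (hφ : φ.IsSentence) :
    Models M (φ.translate []) ↔ Models M.blowUp φ := by
  rcases isEmpty_or_nonempty M.domain with hM | ⟨⟨d⟩⟩
  · have : IsEmpty M.blowUp.domain := inferInstanceAs (IsEmpty (M.domain × ℕ))
    rw [models_of_isEmpty, models_of_isEmpty, trueOnEmpty_translate φ hφ]
  · rw [models_iff_sat M _ (isSentence_translate hφ) fun _ => d,
      models_iff_sat M.blowUp φ hφ fun _ => (d, 0)]
    refine (correct_translate M.val φ [] (fun _ => (d, 0)) ?_ ?_ ?_).symm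
    · intro i hi; simp at hi
    · simp
    · rw [show φ.freeVars = ∅ from hφ]; exact Finset.empty_subset _

theorem equivalent_translate_iff {φ : Formula A} (hφ : φ.IsSentence) :
    Equivalent.{u, v} φ (φ.translate []) ↔ InvariantUnderQuotients.{u, v} φ := by
  constructor
  · intro h M N hNM
    rw [h M, h N]
    exact invariantUnderQuotients_of_isM (isSentence_translate hφ) (isM_translate φ []) M N hNM
  · intro h M
    rw [models_translate_iff M hφ]
    exact (h _ _ (isQuotient_blowUp M)).symm

namespace Formula

/-! ### Effectiveness of the translation -/

/-- The test for `IsWPair` on codes. -/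
def IsWPairCode (m n : ℕ) : Prop :=
  m.unpair.1 = 9 ∧ m.unpair.2.unpair.2.unpair.1 = 6 ∧ n.unpair.1 = 11 ∧
    n.unpair.2.unpair.1 = m.unpair.2.unpair.1 ∧
    n.unpair.2.unpair.2 = m.unpair.2.unpair.2.unpair.2.unpair.2

instance (m n : ℕ) : Decidable (IsWPairCode m n) := by unfold IsWPairCode; infer_instance

theorem isWPairCode_iff [Encodable A] (φ ψ : Formula A) :
    IsWPairCode φ.code ψ.code ↔ IsWPair φ ψ := by
  constructor
  · rintro ⟨h₁, h₂, h₃, h₄, h₅⟩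
    cases φ with
    | all x φ =>
      cases φ with
      | or α β =>
        cases ψ with
        | allInf y γ =>
          simp only [code, Nat.unpair_pair] at h₄ h₅
          exact ⟨x, α, β, rfl, by rw [h₄, code_injective h₅]⟩
        | _ => simp [code] at h₃
      | _ => simp [code] at h₂
    | _ => simp [code] at h₁
  · rintro ⟨x, α, β, rfl, rfl⟩
    simp [IsWPairCode, code]

/-- The arguments of the recursive calls of the translation, on codes. -/
def calls (b : ℕ × List (ℕ × ℕ)) : List (ℕ × List (ℕ × ℕ)) :=
  let t := b.1.unpair.1
  let m := b.1.unpair.2.unpair.1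
  let n := b.1.unpair.2.unpair.2
  if t = 6 ∨ t = 7 then [(m, b.2), (n, b.2)]
  else if t = 8 ∨ t = 9 then
    (n, (m, b.2.length) :: b.2) :: b.2.map fun p => (n, (m, p.2) :: b.2)
  else if t = 10 ∨ t = 11 then [(n, (m, b.2.length) :: b.2)]
  else []

/-- The code of the translation, from the results `r` of the recursive calls, in the order of
`calls`. Numbers that are not codes of formulas get junk values. -/
def combine (b : ℕ × List (ℕ × ℕ)) (r : List ℕ) : ℕ :=
  let t := b.1.unpair.1
  let m := b.1.unpair.2.unpair.1
  let n := b.1.unpair.2.unpair.2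
  if t = 0 ∨ t = 1 then b.1
  else if t = 2 ∨ t = 3 then Nat.pair t (Nat.pair m (value b.2 n))
  else if t = 4 then if value b.2 m = value b.2 n then Nat.pair 0 0 else Nat.pair 1 0
  else if t = 5 then if value b.2 m = value b.2 n then Nat.pair 1 0 else Nat.pair 0 0
  else if t = 6 then Nat.pair 6 (Nat.pair (r.getD 0 0) (r.getD 1 0))
  else if t = 7 then
    -- Tag 7 marks conjunctions, so the inner test computes `leftConjunct` on codes.
    Nat.pair 7 (Nat.pair
      (if IsWPairCode m n ∧ (r.getD 0 0).unpair.1 = 7 then (r.getD 0 0).unpair.2.unpair.1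
        else r.getD 0 0) (r.getD 1 0))
  else if t = 8 then
    Nat.pair 6 (Nat.pair (r.tail.foldr (fun x y => Nat.pair 6 (Nat.pair x y)) (Nat.pair 1 0))
      (Nat.pair 8 (Nat.pair b.2.length (r.getD 0 0))))
  else if t = 9 then
    Nat.pair 7 (Nat.pair (r.tail.foldr (fun x y => Nat.pair 7 (Nat.pair x y)) (Nat.pair 0 0))
      (Nat.pair 9 (Nat.pair b.2.length (r.getD 0 0))))
  else if t = 10 then Nat.pair 8 (Nat.pair b.2.length (r.getD 0 0))
  else Nat.pair 9 (Nat.pair b.2.length (r.getD 0 0))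

theorem calls_lt (b : ℕ × List (ℕ × ℕ)) : ∀ b' ∈ calls b, b'.1 < b.1 := by
  have h₁ := Nat.add_le_pair b.1.unpair.1 b.1.unpair.2
  have h₂ := Nat.unpair_left_le b.1.unpair.2
  have h₃ := Nat.unpair_right_le b.1.unpair.2
  rw [Nat.pair_unpair] at h₁
  intro b' hb'
  simp only [calls] at hb'
  split_ifs at hb' with h h h <;> simp at hb'
  · rcases hb' with rfl | rfl <;> simp only <;> omega
  · rcases hb' with rfl | ⟨a, b, -, rfl⟩ <;> simp only <;> omega
  · subst hb'; simp only; omega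

/-- The translation on codes. -/
def translateCode (b : ℕ × List (ℕ × ℕ)) : ℕ :=
  combine b ((calls b).attach.map fun b' => translateCode b'.1)
termination_by b.1
decreasing_by exact calls_lt b _ b'.2

theorem translateCode_eq (b : ℕ × List (ℕ × ℕ)) :
    translateCode b = combine b ((calls b).map translateCode) := by
  rw [translateCode, List.attach_map_val (f := translateCode)]

theorem primrec_value : Primrec₂ value :=
  Primrec.option_getD.comp (Primrec.listLookup.comp Primrec.snd Primrec.fst) (Primrec.const 0)

theorem primrecRel_isWPairCode : PrimrecRel IsWPairCode := by
  have l : Primrec fun n : ℕ => n.unpair.1 := Primrec.fst.comp Primrec.unpair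
  have r : Primrec fun n : ℕ => n.unpair.2 := Primrec.snd.comp Primrec.unpair
  have m : Primrec fun p : ℕ × ℕ => p.1 := Primrec.fst
  have n : Primrec fun p : ℕ × ℕ => p.2 := Primrec.snd
  exact .and (Primrec.eq.comp (l.comp m) (.const 9)) <|
    .and (Primrec.eq.comp (l.comp (r.comp (r.comp m))) (.const 6)) <|
    .and (Primrec.eq.comp (l.comp n) (.const 11)) <|
    .and (Primrec.eq.comp (l.comp (r.comp n)) (l.comp (r.comp m))) <|
    Primrec.eq.comp (r.comp (r.comp n)) (r.comp (r.comp (r.comp (r.comp m))))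

theorem primrec_calls : Primrec calls := by
  have l : Primrec fun n : ℕ => n.unpair.1 := Primrec.fst.comp Primrec.unpair
  have r : Primrec fun n : ℕ => n.unpair.2 := Primrec.snd.comp Primrec.unpair
  have t : Primrec fun b : ℕ × List (ℕ × ℕ) => b.1.unpair.1 := l.comp Primrec.fst
  have m : Primrec fun b : ℕ × List (ℕ × ℕ) => b.1.unpair.2.unpair.1 :=
    l.comp (r.comp Primrec.fst)
  have n : Primrec fun b : ℕ × List (ℕ × ℕ) => b.1.unpair.2.unpair.2 :=
    r.comp (r.comp Primrec.fst)
  have e : Primrec fun b : ℕ × List (ℕ × ℕ) => b.2 := Primrec.snd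
  have tag (i : ℕ) : PrimrecPred fun b : ℕ × List (ℕ × ℕ) => b.1.unpair.1 = i :=
    Primrec.eq.comp t (.const i)
  have fresh : Primrec fun b : ℕ × List (ℕ × ℕ) =>
      (b.1.unpair.2.unpair.2, (b.1.unpair.2.unpair.1, b.2.length) :: b.2) :=
    n.pair (Primrec.list_cons.comp (m.pair (Primrec.list_length.comp e)) e)
  have old : Primrec₂ fun (b : ℕ × List (ℕ × ℕ)) (p : ℕ × ℕ) =>
      (b.1.unpair.2.unpair.2, (b.1.unpair.2.unpair.1, p.2) :: b.2) :=
    (n.comp Primrec.fst).pair (Primrec.list_cons.comp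
      ((m.comp Primrec.fst).pair (Primrec.snd.comp Primrec.snd)) (e.comp Primrec.fst))
  refine .ite (.or (tag 6) (tag 7)) ?_ <| .ite (.or (tag 8) (tag 9)) ?_ <|
    .ite (.or (tag 10) (tag 11)) ?_ (.const [])
  · exact Primrec.list_cons.comp (m.pair e) (Primrec.list_cons.comp (n.pair e) (.const []))
  · exact Primrec.list_cons.comp fresh (Primrec.list_map e old)
  · exact Primrec.list_cons.comp fresh (.const [])

theorem primrec_combine : Primrec₂ combine := by
  have l : Primrec fun n : ℕ => n.unpair.1 := Primrec.fst.comp Primrec.unpair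
  have r : Primrec fun n : ℕ => n.unpair.2 := Primrec.snd.comp Primrec.unpair
  have c : Primrec fun q : (ℕ × List (ℕ × ℕ)) × List ℕ => q.1.1 :=
    Primrec.fst.comp Primrec.fst
  have t := l.comp c
  have m := l.comp (r.comp c)
  have n := r.comp (r.comp c)
  have e : Primrec fun q : (ℕ × List (ℕ × ℕ)) × List ℕ => q.1.2 :=
    Primrec.snd.comp Primrec.fst
  have len := Primrec.list_length.comp e
  have get (i : ℕ) : Primrec fun q : (ℕ × List (ℕ × ℕ)) × List ℕ => q.2.getD i 0 :=
    (Primrec.list_getD 0).comp Primrec.snd (.const i)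
  have tag (i : ℕ) : PrimrecPred fun q : (ℕ × List (ℕ × ℕ)) × List ℕ => q.1.1.unpair.1 = i :=
    Primrec.eq.comp t (.const i)
  have same : PrimrecPred fun q : (ℕ × List (ℕ × ℕ)) × List ℕ =>
      value q.1.2 q.1.1.unpair.2.unpair.1 = value q.1.2 q.1.1.unpair.2.unpair.2 :=
    Primrec.eq.comp (primrec_value.comp e m) (primrec_value.comp e n)
  have pair {f g : (ℕ × List (ℕ × ℕ)) × List ℕ → ℕ} (hf : Primrec f) (hg : Primrec g) :
      Primrec fun q => Nat.pair (f q) (g q) := Primrec₂.natPair.comp hf hg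
  have fold (i j : ℕ) : Primrec fun q : (ℕ × List (ℕ × ℕ)) × List ℕ =>
      q.2.tail.foldr (fun x y => Nat.pair i (Nat.pair x y)) j :=
    Primrec.list_foldr (h := fun _ p => Nat.pair i (Nat.pair p.1 p.2))
      (Primrec.list_tail.comp Primrec.snd) (.const j)
      (Primrec₂.natPair.comp (.const i) (Primrec₂.natPair.comp
        (Primrec.fst.comp Primrec.snd) (Primrec.snd.comp Primrec.snd)))
  refine .ite (.or (tag 0) (tag 1)) c <|
    .ite (.or (tag 2) (tag 3)) (pair t (pair m (primrec_value.comp e n))) <|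
    .ite (tag 4) (.ite same (.const _) (.const _)) <|
    .ite (tag 5) (.ite same (.const _) (.const _)) <|
    .ite (tag 6) (pair (.const _) (pair (get 0) (get 1))) <|
    .ite (tag 7) (pair (.const _) (pair (.ite ?_ ?_ (get 0)) (get 1))) <|
    .ite (tag 8) (pair (.const _) (pair (fold 6 _) (pair (.const _) (pair len (get 0))))) <|
    .ite (tag 9) (pair (.const _) (pair (fold 7 _) (pair (.const _) (pair len (get 0))))) <|
    .ite (tag 10) (pair (.const _) (pair len (get 0))) <|
    pair (.const _) (pair len (get 0))
  · exact .and (primrecRel_isWPairCode.comp m n) (Primrec.eq.comp (l.comp (get 0)) (.const 7))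
  · exact l.comp (r.comp (get 0))

theorem primrec_translateCode : Primrec translateCode :=
  Primrec.nat_omega_rec' translateCode (m := Prod.fst) (l := calls)
    (g := fun b r => some (combine b r)) Primrec.fst primrec_calls
    (Primrec.option_some.comp primrec_combine) calls_lt fun b => by rw [translateCode_eq]

theorem code_bigOr [Encodable A] (l : List (Formula A)) :
    (bigOr l).code =
      (l.map code).foldr (fun x y => Nat.pair 6 (Nat.pair x y)) (Nat.pair 1 0) := by
  induction l with
  | nil => rfl
  | cons φ l ih => simp only [List.map_cons, List.foldr_cons, ← ih]; rfl

theorem code_bigAnd [Encodable A] (l : List (Formula A)) :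
    (bigAnd l).code =
      (l.map code).foldr (fun x y => Nat.pair 7 (Nat.pair x y)) (Nat.pair 0 0) := by
  induction l with
  | nil => rfl
  | cons φ l ih => simp only [List.map_cons, List.foldr_cons, ← ih]; rfl

theorem code_leftConjunct [Encodable A] (φ : Formula A) :
    (leftConjunct φ).code =
      if φ.code.unpair.1 = 7 then φ.code.unpair.2.unpair.1 else φ.code := by
  cases φ <;> simp [code, leftConjunct]

theorem translateCode_code [Encodable A] (φ : Formula A) :
    ∀ e, translateCode (φ.code, e) = (translate φ e).code := by
  induction φ with
  | top | bot | pred | npred =>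
    intro e
    rw [translateCode_eq]
    simp [combine, code, translate]
  | eq x y | neq x y =>
    intro e
    rw [translateCode_eq]
    by_cases h : value e x = value e y <;> simp [combine, code, translate, h]
  | or φ ψ ih ih' =>
    intro e
    rw [translateCode_eq]
    simp [combine, calls, code, translate, ih, ih']
  | and φ ψ ih ih' =>
    intro e
    rw [translateCode_eq]
    by_cases h : IsWPair φ ψ
    · simp [combine, calls, code, translate, ih, ih', isWPairCode_iff, h, code_leftConjunct]
    · simp [combine, calls, code, translate, ih, ih', isWPairCode_iff, h]
  | ex x φ ih =>
    intro e
    rw [translateCode_eq]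
    simp [combine, calls, code, translate, ih, code_bigOr, Function.comp_def]
  | all x φ ih =>
    intro e
    rw [translateCode_eq]
    simp [combine, calls, code, translate, ih, code_bigAnd, Function.comp_def]
  | exInf x φ ih | allInf x φ ih =>
    intro e
    rw [translateCode_eq]
    simp [combine, calls, code, translate, ih]

end Formula

/-- A map that agrees with the translation in the empty environment is effective. -/
theorem isEffective_of_eq_translate [Encodable A] {S T : Set (Formula A)} (t : S → T)
    (h : ∀ φ : S, (t φ : Formula A) = (φ : Formula A).translate []) : IsEffective t :=
  ⟨fun n => Formula.translateCode (n, []),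
    (Formula.primrec_translateCode.comp (Primrec.id.pair (.const []))).to_comp,
    fun φ => by rw [h, ← Formula.translateCode_code]⟩

end MonadicLogic

theorem theoremt {A : Type u} [Finite A] [Encodable A] :
    (∃ t : PosFOE A → PosM A, IsEffective t ∧
      ∀ φ : PosFOE A, Equivalent.{u, v} (φ : Formula A) (t φ : Formula A) ↔
        InvariantUnderQuotients.{u, v} (φ : Formula A)) ∧
    (∃ t : PosFOEInf A → PosM A, IsEffective t ∧
      (∀ φ : PosFOEInf A, Equivalent.{u, v} (φ : Formula A) (t φ : Formula A) ↔
        InvariantUnderQuotients.{u, v} (φ : Formula A)) ∧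
      ∀ (B : Set A) (φ : PosFOEInf A),
        (φ : Formula A).IsContFOEInf B → (t φ : Formula A).IsContM B) := by
  have mem (φ : Formula A) (hs : φ.IsSentence) (hp : φ.IsPositive) : φ.translate [] ∈ PosM A :=
    ⟨Formula.isSentence_translate hs, Formula.isM_translate φ [],
      Formula.isPositive_translate φ hp []⟩
  exact ⟨⟨fun φ => ⟨_, mem φ φ.2.1 φ.2.2.2⟩, isEffective_of_eq_translate _ fun _ => rfl,
      fun φ => equivalent_translate_iff φ.2.1⟩,
    ⟨fun φ => ⟨_, mem φ φ.2.1 φ.2.2⟩, isEffective_of_eq_translate _ fun _ => rfl,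
      fun φ => equivalent_translate_iff φ.2.1, fun _ _ h => Formula.isContM_translate h []⟩⟩
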